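/- Let $X$ and $Y$ be complex Banach spaces, and let $L(Y,X)$ denote the Banach space of bounded linear operators from $Y$ to $X$, with $L(X)=L(X,X)$. For a bounded operator $T$ on a complex Banach space, let $\sigma(T)$ be its spectrum and let $\operatorname{iso}\sigma(T)$ be the set of isolated points of $\sigma(T)$. The ascent $\operatorname{asc}(T)$ (respectively descent $\operatorname{dsc}(T)$) is the smallest integer $n\ge 0$ with $N(T^n)=N(T^{n+1})$ (respectively $R(T^n)=R(T^{n+1})$), where $N$ and $R$ denote null space and range, and is $\infty$ if no such $n$ exists. The set of poles of $T$ is $$\Pi(T)=\{\lambda\in\sigma(T)\colon \operatorname{asc}(T-\lambda)=\operatorname{dsc}(T-\lambda)<\infty\},$$ and $T$ is called polaroid if $\operatorname{iso}\sigma(T)=\Pi(T)$ (equivalently, if every isolated point of $\sigma(T)$ is a pole of $T$). Let $A\in L(X)$ and $B\in L(Y)$ be polaroid. Then the generalized derivation $\rho\in L(L(Y,X))$ defined by $A$ and $B$, that is, $\rho(U)=AU-UB$ for $U\in L(Y,X)$, is polaroid. -/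

import Mathlib

noncomputable section

namespace BanachOp

variable {E : Type*} [NormedAddCommGroup E] [NormedSpace ℂ E]
variable {X : Type*} [NormedAddCommGroup X] [NormedSpace ℂ X]
variable {Y : Type*} [NormedAddCommGroup Y] [NormedSpace ℂ Y]

/-- The ascent of `T`: the smallest `n` with `N(T ^ n) = N(T ^ (n + 1))`, and `⊤` if there is
no such `n`. -/
def ascent (T : E →L[ℂ] E) : ℕ∞ :=
  ⨅ (n : ℕ) (_ : (T ^ n).ker = (T ^ (n + 1)).ker), (n : ℕ∞)

/-- The descent of `T`: the smallest `n` with `R(T ^ n) = R(T ^ (n + 1))`, and `⊤` if there is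
no such `n`. -/
def descent (T : E →L[ℂ] E) : ℕ∞ :=
  ⨅ (n : ℕ) (_ : (T ^ n).range = (T ^ (n + 1)).range), (n : ℕ∞)

/-- The isolated points `iso K = K \ acc K` of a set `K` of complex numbers. -/
def iso (K : Set ℂ) : Set ℂ := K \ derivedSet K

/-- The set `Π(T)` of poles of `T`: the points `z` of the spectrum at which `T - z` has
finite and equal ascent and descent. -/
def poles (T : E →L[ℂ] E) : Set ℂ :=
  {z | z ∈ spectrum ℂ T ∧
    ascent (T - z • ContinuousLinearMap.id ℂ E) = descent (T - z • ContinuousLinearMap.id ℂ E) ∧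
    ascent (T - z • ContinuousLinearMap.id ℂ E) < ⊤}

/-- `T` is polaroid if the isolated points of its spectrum are exactly its poles. -/
def IsPolaroid (T : E →L[ℂ] E) : Prop :=
  iso (spectrum ℂ T) = poles T

/-- The generalized derivation `U ↦ A U - U B` on the space of bounded operators `Y → X`. -/
def generalizedDerivation (A : X →L[ℂ] X) (B : Y →L[ℂ] Y) : (Y →L[ℂ] X) →L[ℂ] (Y →L[ℂ] X) :=
  ContinuousLinearMap.compL ℂ Y X X A - (ContinuousLinearMap.compL ℂ Y Y X).flip B

theorem generalizedDerivation_apply (A : X →L[ℂ] X) (B : Y →L[ℂ] Y) (U : Y →L[ℂ] X) :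
    generalizedDerivation A B U = A.comp U - U.comp B := rfl

end BanachOp

end

namespace BanachOp

/-! A point z of σ(T) is a pole exactly when T - z has a spectral idempotent (`mem_poles_iff`). This
condition is purely algebraic, so it passes from A and B to the left and right multiplications L_A
and R_B. These commute, and ρ = L_A - R_B.

Let z be isolated in σ(ρ), and let F be the set of α in σ(A) with α - z in σ(B). The inclusion σ(A)
- σ(B) ⊆ σ(ρ) (`sub_mem_spectrum_generalizedDerivation`) forces every such α, and its partner α - z,
to be isolated. They are therefore poles, and F, being compact, is finite.

Inside the bicommutant of L_A and R_B, a commutative Banach algebra, let p_α and q_α be the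
idempotents of L_A - α and R_B - (α - z). Then 1 - ∏(1 - p_α q_α) is a spectral idempotent of ρ - z:
nilpotency is algebra, and invertibility is tested on characters
(`hasSpectralIdempotent_sub_of_comm`). -/

/-- An element `t` of a ring has a *spectral idempotent at zero* if some idempotent `p` commuting
with `t` splits it into a nilpotent part `t * p` and a part that is invertible off `p`. -/
def HasSpectralIdempotent {R : Type*} [Ring R] (t : R) : Prop :=
  ∃ p, IsIdempotentElem p ∧ Commute t p ∧ IsNilpotent (t * p) ∧ IsUnit (t + p)

/-! ### Spectral idempotents in rings. -/

section Ring

variable {R S : Type*} [Ring R] [Ring S]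

theorem HasSpectralIdempotent.map {F : Type*} [FunLike F R S] [RingHomClass F R S] (f : F) {t : R}
    (ht : HasSpectralIdempotent t) : HasSpectralIdempotent (f t) := by
  obtain ⟨p, hp, hc, hn, hu⟩ := ht
  refine ⟨f p, hp.map f, hc.map f, ?_, ?_⟩
  · simpa using hn.map f
  · simpa using hu.map f

/-- Needed because right multiplication reverses products. -/
theorem HasSpectralIdempotent.op {t : R} (ht : HasSpectralIdempotent t) :
    HasSpectralIdempotent (MulOpposite.op t) := by
  obtain ⟨p, hp, hc, ⟨n, hn⟩, hu⟩ := ht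
  refine ⟨MulOpposite.op p, ?_, hc.op, ⟨n, ?_⟩, ?_⟩
  · rw [IsIdempotentElem, ← MulOpposite.op_mul, hp.eq]
  · rw [← MulOpposite.op_mul, ← hc.eq, ← MulOpposite.op_pow, hn, MulOpposite.op_zero]
  · simpa using hu.op

/-- The power `(t + p) ^ n` agrees with `t ^ n` off the idempotent `p`. -/
theorem add_pow_mul_one_sub {t p : R} (hp : IsIdempotentElem p) (hc : Commute t p) (n : ℕ) :
    (t + p) ^ n * (1 - p) = t ^ n * (1 - p) := by
  have hp' : p * (1 - p) = 0 := by rw [mul_sub, mul_one, hp.eq, sub_self]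
  have hc' : Commute t (1 - p) := (Commute.one_right t).sub_right hc
  induction n with
  | zero => simp
  | succ n ih =>
    rw [pow_succ, mul_assoc, add_mul, hp', add_zero, hc'.eq, ← mul_assoc, ih, mul_assoc, ← hc'.eq,
      ← mul_assoc, ← pow_succ]

theorem pow_mul_idempotent {t p : R} (hp : IsIdempotentElem p) (hc : Commute t p) {n : ℕ}
    (hn : n ≠ 0) : (t * p) ^ n = t ^ n * p := by
  rw [hc.mul_pow, hp.pow_eq hn]

/-- A spectral idempotent of `t` at zero commutes with everything that commutes with `t`. -/
theorem commute_of_spectralIdempotent {t p c : R} (hp : IsIdempotentElem p) (hc : Commute t p)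
    (hn : IsNilpotent (t * p)) (hu : IsUnit (t + p)) (h : Commute t c) : Commute p c := by
  obtain ⟨n, hn⟩ := hn
  have hz : t ^ (n + 1) * p = 0 := by
    rw [← pow_mul_idempotent hp hc n.succ_ne_zero, pow_succ, hn, zero_mul]
  have hcp : Commute (t ^ (n + 1)) p := hc.pow_left _
  have hcc : Commute (t ^ (n + 1)) c := h.pow_left _
  have hu' : IsUnit ((t + p) ^ (n + 1)) := hu.pow _
  have hup : Commute ((t + p) ^ (n + 1)) p := (hc.add_left (Commute.refl p)).pow_left _
  have hpow := add_pow_mul_one_sub hp hc (n + 1)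
  set s := t ^ (n + 1)
  set u := (t + p) ^ (n + 1)
  have hq : Commute s (1 - p) := (Commute.one_right s).sub_right hcp
  have huq : Commute u (1 - p) := (Commute.one_right u).sub_right hup
  -- On the range of 1 - p the unit u acts as s, and s commutes with c and kills p; so u annihilates
  -- this corner. The other corner is symmetric.
  have h1 : (1 - p) * c * p = 0 := by
    apply hu'.mul_left_cancel
    rw [mul_zero, ← mul_assoc, ← mul_assoc, hpow, hq.eq, mul_assoc (1 - p), hcc.eq, mul_assoc,
      mul_assoc, hz, mul_zero, mul_zero]
  have h2 : p * c * (1 - p) = 0 := by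
    apply hu'.mul_right_cancel
    rw [zero_mul, mul_assoc, ← huq.eq, hpow, mul_assoc, ← mul_assoc c, ← hcc.eq, mul_assoc,
      ← mul_assoc, ← hcp.eq, hz, zero_mul]
  have h3 : c * p = p * c * p := by
    rwa [sub_mul, sub_mul, one_mul, sub_eq_zero] at h1
  have h4 : p * c = p * c * p := by
    rwa [mul_sub, mul_one, sub_eq_zero] at h2
  exact h4.trans h3.symm

/-- A spectral idempotent of `t` may be detected on a positive power of `t`. -/
theorem hasSpectralIdempotent_of_pow {t p : R} (hp : IsIdempotentElem p) (hc : Commute t p) {n : ℕ}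
    (hz : t ^ (n + 1) * p = 0) (hu : IsUnit (t ^ (n + 1) + p)) : HasSpectralIdempotent t := by
  have hn : IsNilpotent (t * p) := ⟨n + 1, by rw [pow_mul_idempotent hp hc n.succ_ne_zero, hz]⟩
  refine ⟨p, hp, hc, hn, ?_⟩
  have hpp : p * (1 - p) = 0 := by rw [mul_sub, mul_one, hp.eq, sub_self]
  have hqp : (1 - p) * p = 0 := by rw [sub_mul, one_mul, hp.eq, sub_self]
  have hqq : (1 - p) * (1 - p) = 1 - p := hp.one_sub.eq
  have hq (k : ℕ) : Commute (t ^ k) (1 - p) := (Commute.one_right _).sub_right (hc.pow_left k)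
  have hmul (j k : ℕ) : (t ^ j * (1 - p) + p) * (t ^ k * (1 - p) + p) =
      t ^ (j + k) * (1 - p) + p := by
    rw [mul_add, add_mul, add_mul, mul_assoc (t ^ j), ← mul_assoc (1 - p), ← (hq k).eq,
      mul_assoc (t ^ k), hqq, ← mul_assoc, ← pow_add, mul_assoc (t ^ j), hqp, mul_zero, zero_add,
      (hq k).eq, ← mul_assoc p, hpp, zero_mul, add_zero, hp.eq]
  have hall : t ^ (n + 1) * (1 - p) + p = t ^ (n + 1) + p := by
    rw [mul_sub, mul_one, hz, sub_zero]
  -- A factor of a unit is a unit when the two factors commute; the cofactor is t ^ n * (1 - p) + p.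
  have hy : IsUnit (t * (1 - p) + p) := by
    have h1 := hmul 1 n
    have h2 := hmul n 1
    rw [pow_one, add_comm 1 n, hall] at h1
    rw [pow_one, hall] at h2
    rw [← h1] at hu
    exact ((show Commute _ _ from h1.trans h2.symm).isUnit_mul_iff.1 hu).1
  have : t + p = (t * (1 - p) + p) * (1 + t * p) := by
    rw [mul_add, mul_one, add_mul, hc.eq, mul_assoc t, ← mul_assoc (1 - p), hqp, zero_mul, mul_zero,
      zero_add, ← mul_assoc, hp.eq, ← hc.eq, mul_sub, mul_one]
    abel
  rw [this]
  exact hy.mul hn.isUnit_one_add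

end Ring

/-! ### Passage to the double centralizer. -/

section Bicommutant

variable {R : Type*} [Ring R] [Algebra ℂ R]

/-- The double centralizer of a set, as a complex subalgebra. -/
abbrev bicommutant (s : Set R) : Subalgebra ℂ R :=
  Subalgebra.centralizer ℂ (s.centralizer)

theorem subset_bicommutant (s : Set R) : s ⊆ bicommutant s :=
  Set.subset_centralizer_centralizer

/-- An inverse commutes with whatever the element commutes with, so invertibility does not depend on
the algebra. -/
theorem isUnit_bicommutant {s : Set R} {x : bicommutant s} (hx : IsUnit (x : R)) : IsUnit x := by
  obtain ⟨u, hu⟩ := hx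
  have hmem : (↑u⁻¹ : R) ∈ bicommutant s := by
    rw [Subalgebra.mem_centralizer_iff]
    intro g hg
    have : Commute g (u : R) := hu ▸ (Subalgebra.mem_centralizer_iff ℂ).1 x.2 g hg
    exact this.units_inv_right
  refine ⟨⟨x, ⟨_, hmem⟩, ?_, ?_⟩, rfl⟩ <;> ext <;> simp [← hu]

theorem HasSpectralIdempotent.bicommutant {s : Set R} {x : bicommutant s}
    (hx : HasSpectralIdempotent (x : R)) : HasSpectralIdempotent x := by
  obtain ⟨p, hp, hc, hn, hu⟩ := hx
  have hmem : p ∈ BanachOp.bicommutant s := by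
    rw [Subalgebra.mem_centralizer_iff]
    intro g hg
    have : Commute g (x : R) := (Subalgebra.mem_centralizer_iff ℂ).1 x.2 g hg
    exact (commute_of_spectralIdempotent hp hc hn hu this.symm).symm
  obtain ⟨n, hn⟩ := hn
  refine ⟨⟨p, hmem⟩, Subtype.ext hp, Subtype.ext hc, ⟨n, Subtype.ext ?_⟩, isUnit_bicommutant ?_⟩
  · simpa using hn
  · simpa using hu

end Bicommutant

section BanachAlgebra

variable {R : Type*} [NormedRing R] [NormedAlgebra ℂ R]

/-- The double centralizer of a commuting pair is a commutative Banach algebra. -/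
abbrev bicommutantNormedCommRing {a b : R} (h : Commute a b) :
    NormedCommRing (bicommutant ({a, b} : Set R)) :=
  { (inferInstance : NormedRing (bicommutant ({a, b} : Set R))) with
    mul_comm := fun x y => by
      have hsub : (bicommutant ({a, b} : Set R) : Set R) ⊆ Set.centralizer {a, b} := by
        refine Set.centralizer_subset ?_
        rintro z (rfl | rfl) w (rfl | rfl)
        exacts [rfl, h.symm, h, rfl]
      exact Subtype.ext ((Subalgebra.mem_centralizer_iff ℂ).1 y.2 x (hsub x.2)) }

theorem completeSpace_bicommutant [CompleteSpace R] (s : Set R) :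
    CompleteSpace (bicommutant s) :=
  (Set.isClosed_centralizer (s.centralizer)).completeSpace_coe

end BanachAlgebra

/-! ### Character arguments in commutative Banach algebras. -/

section Commutative

variable {C : Type*} [NormedCommRing C] [NormedAlgebra ℂ C] [CompleteSpace C]

theorem isUnit_of_forall_character {x : C} (h : ∀ χ : C →ₐ[ℂ] ℂ, χ x ≠ 0) : IsUnit x := by
  by_contra hx
  obtain ⟨f, hf⟩ := WeakDual.CharacterSpace.exists_apply_eq_zero hx
  exact h (WeakDual.CharacterSpace.equivAlgHom f) hf

/-- A character takes a spectral idempotent of `t` to `1` if it kills `t`, and to `0` otherwise. -/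
theorem character_spectralIdempotent {t p : C} (hp : IsIdempotentElem p)
    (hn : IsNilpotent (t * p)) (hu : IsUnit (t + p)) (χ : C →ₐ[ℂ] ℂ) :
    (χ t = 0 ∧ χ p = 1) ∨ (χ t ≠ 0 ∧ χ p = 0) := by
  have h1 : χ t * χ p = 0 := by simpa using (hn.map χ).eq_zero
  have h2 : χ t + χ p ≠ 0 := by simpa using (hu.map χ).ne_zero
  rcases IsIdempotentElem.iff_eq_zero_or_one.1 (hp.map χ) with h | h
  · exact Or.inr ⟨by simpa [h] using h2, h⟩
  · exact Or.inl ⟨by simpa [h] using h1, h⟩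

/-- For small w the element t + p - w is still a unit. A character killing t sends t - w to -w ≠ 0;
any other kills p, so it takes the same nonzero value on t - w as on t + p - w. -/
theorem HasSpectralIdempotent.eventually_isUnit_of_comm {t : C} (ht : HasSpectralIdempotent t) :
    ∀ᶠ w in nhdsWithin (0 : ℂ) {0}ᶜ, IsUnit (t - algebraMap ℂ C w) := by
  obtain ⟨p, hp, -, hn, hu⟩ := ht
  have hcont : Filter.Tendsto (fun w : ℂ => t + p - algebraMap ℂ C w) (nhds 0) (nhds (t + p)) := by
    have : Continuous fun w : ℂ => t + p - algebraMap ℂ C w := by fun_prop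
    simpa using this.tendsto 0
  have hev := hcont.eventually (Units.isOpen.mem_nhds hu)
  filter_upwards [nhdsWithin_le_nhds hev, self_mem_nhdsWithin] with w hw hw0
  refine isUnit_of_forall_character fun χ hχ => ?_
  have hw' : χ (t + p - algebraMap ℂ C w) ≠ 0 := ((show IsUnit _ from hw).map χ).ne_zero
  rw [map_sub, AlgHom.commutes, Algebra.algebraMap_self_apply] at hχ hw'
  rw [map_add] at hw'
  rcases character_spectralIdempotent hp hn hu χ with h | h
  · exact hw0 (by simpa [h.1] using hχ)
  · exact hw' (by simpa [h.2] using hχ)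

/-- If every character `χ` with `χ a - χ b = z` takes `a` into a finite set at whose points `a` and,
after translation by `z`, `b` have spectral idempotents, then so does `a - b` at `z`. -/
theorem hasSpectralIdempotent_sub_of_comm {a b : C} {z : ℂ} (s : Finset ℂ)
    (ha : ∀ α ∈ s, HasSpectralIdempotent (a - algebraMap ℂ C α))
    (hb : ∀ α ∈ s, HasSpectralIdempotent (b - algebraMap ℂ C (α - z)))
    (hχ : ∀ χ : C →ₐ[ℂ] ℂ, χ a - χ b = z → χ a ∈ s) :
    HasSpectralIdempotent (a - b - algebraMap ℂ C z) := by
  choose! p hp _ hpn hpu using ha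
  choose! q hq _ hqn hqu using hb
  have hprod : ∀ r : Finset ℂ, r ⊆ s → IsIdempotentElem (∏ α ∈ r, (1 - p α * q α)) ∧
      IsNilpotent ((a - b - algebraMap ℂ C z) * (1 - ∏ α ∈ r, (1 - p α * q α))) := by
    intro r
    induction r using Finset.induction_on with
    | empty => simp [IsIdempotentElem.one]
    | insert α r hαr ih =>
      intro hr
      obtain ⟨h1, h2⟩ := ih ((Finset.subset_insert _ _).trans hr)
      have hα : α ∈ s := hr (Finset.mem_insert_self _ _)
      rw [Finset.prod_insert hαr]
      refine ⟨((hp α hα).mul (hq α hα)).one_sub.mul h1, ?_⟩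
      -- Split a - b - z as (a - α) - (b - (α - z)); each half is nilpotent on p α * q α.
      have h3 : IsNilpotent ((a - b - algebraMap ℂ C z) * (p α * q α)) := by
        have : (a - b - algebraMap ℂ C z) * (p α * q α) =
            q α * ((a - algebraMap ℂ C α) * p α) -
              p α * ((b - algebraMap ℂ C (α - z)) * q α) := by
          rw [map_sub]; ring
        rw [this]
        exact (Commute.all _ _).isNilpotent_sub ((Commute.all _ _).isNilpotent_mul_left (hpn α hα))
          ((Commute.all _ _).isNilpotent_mul_left (hqn α hα))
      have h4 : (a - b - algebraMap ℂ C z) *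
            (1 - (1 - p α * q α) * ∏ β ∈ r, (1 - p β * q β)) =
          (a - b - algebraMap ℂ C z) * (1 - ∏ β ∈ r, (1 - p β * q β)) +
            (∏ β ∈ r, (1 - p β * q β)) * ((a - b - algebraMap ℂ C z) * (p α * q α)) := by
        ring
      rw [h4]
      exact (Commute.all _ _).isNilpotent_add h2 ((Commute.all _ _).isNilpotent_mul_left h3)
  obtain ⟨hidem, hnil⟩ := hprod s subset_rfl
  refine ⟨_, hidem.one_sub, Commute.all _ _, hnil, isUnit_of_forall_character fun χ hzero => ?_⟩
  simp only [map_add, map_sub, map_prod, map_mul, map_one, AlgHom.commutes,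
    Algebra.algebraMap_self_apply] at hzero
  have hchar (α : ℂ) (hα : α ∈ s) :=
    And.intro (character_spectralIdempotent (hp α hα) (hpn α hα) (hpu α hα) χ)
      (character_spectralIdempotent (hq α hα) (hqn α hα) (hqu α hα) χ)
  simp only [map_sub, AlgHom.commutes, Algebra.algebraMap_self_apply] at hchar
  -- If χ a - χ b = z, the factor at α = χ a vanishes and the tested element has value 1. Otherwise
  -- every factor is 1, and its value is χ a - χ b - z ≠ 0.
  by_cases hz : χ a - χ b = z
  · have hs := hχ χ hz
    have hfac : 1 - χ (p (χ a)) * χ (q (χ a)) = 0 := by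
      obtain ⟨h1 | h1, h2 | h2⟩ := hchar _ hs
      · simp [h1.2, h2.2]
      · exact absurd (by rw [← hz]; ring) h2.1
      · exact absurd (sub_self _) h1.1
      · exact absurd (sub_self _) h1.1
    rw [Finset.prod_eq_zero hs hfac, hz] at hzero
    simp at hzero
  · have hone : ∏ α ∈ s, (1 - χ (p α) * χ (q α)) = 1 := by
      refine Finset.prod_eq_one fun α hα => ?_
      obtain ⟨h1 | h1, h2 | h2⟩ := hchar _ hα
      · exact absurd (by linear_combination h1.1 - h2.1) hz
      all_goals simp [h1.2, h2.2]
    rw [hone] at hzero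
    exact hz (by linear_combination hzero)

end Commutative

section Noncommutative

variable {R : Type*} [NormedRing R] [NormedAlgebra ℂ R] [CompleteSpace R]

theorem HasSpectralIdempotent.eventually_isUnit {t : R} (ht : HasSpectralIdempotent t) :
    ∀ᶠ w in nhdsWithin (0 : ℂ) {0}ᶜ, IsUnit (t - algebraMap ℂ R w) := by
  let _ := bicommutantNormedCommRing (Commute.refl t)
  have := completeSpace_bicommutant ({t, t} : Set R)
  let t' : BanachOp.bicommutant ({t, t} : Set R) := ⟨t, subset_bicommutant _ (by simp)⟩
  have ht' : HasSpectralIdempotent t' := HasSpectralIdempotent.bicommutant ht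
  filter_upwards [ht'.eventually_isUnit_of_comm] with w hw
  exact hw.map (BanachOp.bicommutant ({t, t} : Set R)).val

/-- Noncommutative form of `hasSpectralIdempotent_sub_of_comm`, in terms of spectra. -/
theorem hasSpectralIdempotent_sub {a b : R} (hab : Commute a b) {z : ℂ} (s : Finset ℂ)
    (ha : ∀ α ∈ s, HasSpectralIdempotent (a - algebraMap ℂ R α))
    (hb : ∀ α ∈ s, HasSpectralIdempotent (b - algebraMap ℂ R (α - z)))
    (hs : ∀ α ∈ spectrum ℂ a, α - z ∈ spectrum ℂ b → α ∈ s) :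
    HasSpectralIdempotent (a - b - algebraMap ℂ R z) := by
  let _ := bicommutantNormedCommRing hab
  have := completeSpace_bicommutant ({a, b} : Set R)
  let a' : bicommutant ({a, b} : Set R) := ⟨a, subset_bicommutant _ (by simp)⟩
  let b' : bicommutant ({a, b} : Set R) := ⟨b, subset_bicommutant _ (by simp)⟩
  have hspec (x : bicommutant ({a, b} : Set R)) (χ : bicommutant ({a, b} : Set R) →ₐ[ℂ] ℂ) :
      χ x ∈ spectrum ℂ (x : R) := by
    intro hx
    have : IsUnit (algebraMap ℂ (bicommutant ({a, b} : Set R)) (χ x) - x) := isUnit_bicommutant hx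
    exact (this.map χ).ne_zero (by simp)
  have key : HasSpectralIdempotent (a' - b' - algebraMap ℂ (bicommutant ({a, b} : Set R)) z) := by
    refine hasSpectralIdempotent_sub_of_comm s
      (fun α hα => HasSpectralIdempotent.bicommutant (ha α hα))
      (fun α hα => HasSpectralIdempotent.bicommutant (hb α hα)) fun χ hχ => ?_
    refine hs _ (hspec a' χ) ?_
    have : χ a' - z = χ b' := by rw [← hχ]; ring
    rw [this]
    exact hspec b' χ
  exact key.map (bicommutant ({a, b} : Set R)).val

end Noncommutative

end BanachOp

namespace BanachOp

open ContinuousLinearMap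

/-! ### Approximate kernels, and non-invertibility of the generalized derivation. -/

section Approximate

variable {E : Type*} [NormedAddCommGroup E] [NormedSpace ℂ E]
variable {X : Type*} [NormedAddCommGroup X] [NormedSpace ℂ X]
variable {Y : Type*} [NormedAddCommGroup Y] [NormedSpace ℂ Y]

/-- `T` is not bounded below. -/
def HasApproxKernel (T : E →L[ℂ] E) : Prop :=
  ∀ ε > 0, ∃ x, ‖T x‖ < ε * ‖x‖

/-- The adjoint of `T` on the dual space is not bounded below. -/
def HasApproxCokernel (T : E →L[ℂ] E) : Prop :=
  ∀ ε > 0, ∃ f : StrongDual ℂ E, ‖f ∘L T‖ < ε * ‖f‖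

/-- An operator bounded below with dense range is invertible. If the range is not dense, Hahn–Banach
on the quotient by its closure gives a nonzero functional annihilating it. -/
theorem hasApproxKernel_or_hasApproxCokernel [CompleteSpace E] {T : E →L[ℂ] E} (hT : ¬ IsUnit T) :
    HasApproxKernel T ∨ HasApproxCokernel T := by
  by_contra! h
  obtain ⟨h1, h2⟩ := h
  simp only [HasApproxKernel, HasApproxCokernel, not_forall, not_exists, not_lt] at h1 h2
  obtain ⟨ε, hε, h1⟩ := h1
  obtain ⟨δ, hδ, h2⟩ := h2
  apply hT
  rw [isUnit_iff_bijective, bijective_iff_dense_range_and_antilipschitz]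
  refine ⟨?_, ⟨ε⁻¹, by positivity⟩, ?_⟩
  · by_contra hne
    obtain ⟨x, hx⟩ : ∃ x, x ∉ T.range.topologicalClosure := by
      by_contra! hall
      exact hne (eq_top_iff.2 fun x _ => hall x)
    have : IsClosed (T.range.topologicalClosure : Set E) :=
      T.range.isClosed_topologicalClosure
    have hx0 : ‖(T.range.topologicalClosure.mkQ x)‖ ≠ 0 := by
      rw [norm_ne_zero_iff, Submodule.mkQ_apply, Ne, Submodule.Quotient.mk_eq_zero]
      exact hx
    obtain ⟨g, hg, hgx⟩ := exists_dual_vector ℂ _ hx0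
    have hgT : (g ∘L T.range.topologicalClosure.mkQL) ∘L T = 0 := by
      ext y
      have : T.range.topologicalClosure.mkQ (T y) = 0 := by
        rw [Submodule.mkQ_apply, Submodule.Quotient.mk_eq_zero]
        exact T.range.le_topologicalClosure ⟨y, rfl⟩
      change g (T.range.topologicalClosure.mkQ (T y)) = 0
      rw [this, map_zero]
    have h3 := h2 (g ∘L T.range.topologicalClosure.mkQL)
    rw [hgT, norm_zero] at h3
    have h4 : g ∘L T.range.topologicalClosure.mkQL = 0 :=
      norm_le_zero_iff.1 (nonpos_of_mul_nonpos_right h3 hδ)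
    have h5 : g (T.range.topologicalClosure.mkQ x) = 0 := DFunLike.congr_fun h4 x
    rw [h5] at hgx
    exact hx0 (Complex.ofReal_eq_zero.1 hgx.symm)
  · refine AddMonoidHomClass.antilipschitz_of_bound T fun x => ?_
    change ‖x‖ ≤ ε⁻¹ * ‖T x‖
    rw [← div_eq_inv_mul, le_div_iff₀' hε]
    exact h1 x

theorem isUnit_of_norm_inv_le {R : Type*} [NormedRing R] [CompleteSpace R] {t : R} (v : Rˣ) {ε : ℝ}
    (hε : 0 < ε) (hv : ‖(↑v⁻¹ : R)‖ ≤ ε⁻¹) (h : dist t v < ε) : IsUnit t := by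
  nontriviality R
  refine ⟨v.ofNearby t ?_, rfl⟩
  rw [← dist_eq_norm]
  exact h.trans_le ((le_inv_comm₀ hε v⁻¹.norm_pos).2 hv)

/-- If T were bounded below by ε, an invertible v within ε / 2 would be bounded below by ε / 2. The
norm of its inverse is then at most 2 / ε, and T lies in the Neumann ball of v. -/
theorem hasApproxKernel_of_mem_closure [CompleteSpace E] {T : E →L[ℂ] E} (hT : ¬ IsUnit T)
    (hcl : T ∈ closure {V : E →L[ℂ] E | IsUnit V}) : HasApproxKernel T := by
  intro ε hε
  by_contra! h
  obtain ⟨_, ⟨v, rfl⟩, hv⟩ := Metric.mem_closure_iff.1 hcl (ε / 2) (by positivity)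
  refine hT (isUnit_of_norm_inv_le v (half_pos hε) ?_ hv)
  refine opNorm_le_bound _ (by positivity) fun x => ?_
  set y := (↑v⁻¹ : E →L[ℂ] E) x with hy
  have hx : (v : E →L[ℂ] E) y = x := by
    rw [hy, ← mul_apply_eq_comp, v.mul_inv, one_apply_eq_self]
  have h1 : ‖T y - (v : E →L[ℂ] E) y‖ ≤ ε / 2 * ‖y‖ := by
    rw [← sub_apply]
    refine ((T - (v : E →L[ℂ] E)).le_opNorm y).trans ?_
    gcongr
    rw [← dist_eq_norm]; exact hv.le
  have h2 := norm_sub_norm_le (T y) ((v : E →L[ℂ] E) y)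
  rw [← div_eq_inv_mul, le_div_iff₀' (half_pos hε)]
  rw [hx] at h1 h2
  linarith [h y]

/-- The same argument on functionals, with ‖v⁻¹ x‖ read off through a norming functional. -/
theorem hasApproxCokernel_of_mem_closure [CompleteSpace E] {T : E →L[ℂ] E} (hT : ¬ IsUnit T)
    (hcl : T ∈ closure {V : E →L[ℂ] E | IsUnit V}) : HasApproxCokernel T := by
  intro ε hε
  by_contra! h
  obtain ⟨_, ⟨v, rfl⟩, hv⟩ := Metric.mem_closure_iff.1 hcl (ε / 2) (by positivity)
  refine hT (isUnit_of_norm_inv_le v (half_pos hε) ?_ hv)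
  refine opNorm_le_bound _ (by positivity) fun x => ?_
  obtain ⟨g, hg, hgx⟩ := exists_dual_vector'' ℂ ((↑v⁻¹ : E →L[ℂ] E) x)
  set f := g ∘L (↑v⁻¹ : E →L[ℂ] E) with hf
  have hfg : f ∘L (v : E →L[ℂ] E) = g := by
    rw [hf, comp_assoc, ← mul_def, v.inv_mul]; rfl
  have h1 : ‖f ∘L T - g‖ ≤ ‖f‖ * (ε / 2) := by
    rw [← hfg, ← comp_sub]
    refine (opNorm_comp_le _ _).trans ?_
    gcongr
    rw [← dist_eq_norm]; exact hv.le
  have h2 := norm_sub_norm_le (f ∘L T) g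
  have h3 : ‖f‖ ≤ (ε / 2)⁻¹ := by
    rw [← one_div, le_div_iff₀ (half_pos hε)]
    linarith [h f]
  have h4 : ‖(↑v⁻¹ : E →L[ℂ] E) x‖ = ‖f x‖ := by
    rw [hf, comp_apply, hgx]; simp
  rw [h4]
  exact (f.le_opNorm x).trans (by gcongr)

/-- The rank-one operator built from approximate null vectors f and x is an approximate null vector
of the derivation. -/
theorem not_isUnit_generalizedDerivation_of_kernel_cokernel {A : X →L[ℂ] X} {B : Y →L[ℂ] Y}
    (hA : HasApproxKernel A) (hB : HasApproxCokernel B) :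
    ¬ IsUnit (generalizedDerivation A B) := by
  rintro ⟨v, hv⟩
  set K := ‖(↑v⁻¹ : (Y →L[ℂ] X) →L[ℂ] (Y →L[ℂ] X))‖
  have hK0 : 0 ≤ K := opNorm_nonneg _
  -- Chosen so that 2 * ε * K < 1.
  have hε : 0 < (2 * (K + 1))⁻¹ := by positivity
  obtain ⟨x, hx⟩ := hA _ hε
  obtain ⟨f, hf⟩ := hB _ hε
  set ε := (2 * (K + 1))⁻¹
  have hx0 : 0 < ‖x‖ := pos_of_mul_pos_right ((norm_nonneg _).trans_lt hx) hε.le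
  have hf0 : 0 < ‖f‖ := pos_of_mul_pos_right ((norm_nonneg _).trans_lt hf) hε.le
  have hU : generalizedDerivation A B (f.smulRight x) =
      f.smulRight (A x) - (f ∘L B).smulRight x := by
    ext y
    simp [generalizedDerivation_apply]
  have h1 : ‖generalizedDerivation A B (f.smulRight x)‖ ≤ 2 * ε * (‖f‖ * ‖x‖) := by
    rw [hU]
    refine (norm_sub_le _ _).trans ?_
    rw [norm_smulRight_apply, norm_smulRight_apply]
    nlinarith
  have h2 : f.smulRight x = (↑v⁻¹ : (Y →L[ℂ] X) →L[ℂ] (Y →L[ℂ] X))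
      (generalizedDerivation A B (f.smulRight x)) := by
    rw [← hv, ← mul_apply_eq_comp, v.inv_mul, one_apply_eq_self]
  have h3 : ‖f‖ * ‖x‖ ≤ K * (2 * ε * (‖f‖ * ‖x‖)) := by
    rw [← norm_smulRight_apply]
    nth_rewrite 1 [h2]
    refine (le_opNorm _ _).trans ?_
    rw [norm_smulRight_apply]
    gcongr
  have h4 : ε * (2 * (K + 1)) = 1 := inv_mul_cancel₀ (by positivity)
  have h5 : 0 < ‖f‖ * ‖x‖ := by positivity
  have h6 : K * (2 * ε) < 1 := by nlinarith
  nlinarith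

/-- Here surjectivity fails quantitatively: if AV - VB is the rank-one operator h ⊗ w, evaluating at
y and applying f makes f w too small for every w. -/
theorem not_isUnit_generalizedDerivation_of_cokernel_kernel {A : X →L[ℂ] X} {B : Y →L[ℂ] Y}
    (hA : HasApproxCokernel A) (hB : HasApproxKernel B) :
    ¬ IsUnit (generalizedDerivation A B) := by
  rintro ⟨v, hv⟩
  set K := ‖(↑v⁻¹ : (Y →L[ℂ] X) →L[ℂ] (Y →L[ℂ] X))‖
  have hK0 : 0 ≤ K := opNorm_nonneg _
  have hε : 0 < (2 * (K + 1))⁻¹ := by positivity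
  obtain ⟨y, hy⟩ := hB _ hε
  obtain ⟨f, hf⟩ := hA _ hε
  set ε := (2 * (K + 1))⁻¹
  have hy0 : 0 < ‖y‖ := pos_of_mul_pos_right ((norm_nonneg _).trans_lt hy) hε.le
  have hf0 : 0 < ‖f‖ := pos_of_mul_pos_right ((norm_nonneg _).trans_lt hf) hε.le
  obtain ⟨h, hh, hhy⟩ := exists_dual_vector ℂ y hy0.ne'
  have hbound (w : X) : ‖f w‖ ≤ 2 * ε * K * ‖f‖ * ‖w‖ := by
    set V := (↑v⁻¹ : (Y →L[ℂ] X) →L[ℂ] (Y →L[ℂ] X)) (h.smulRight w) with hV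
    have hVn : ‖V‖ ≤ K * ‖w‖ := by
      refine (le_opNorm _ _).trans ?_
      rw [norm_smulRight_apply, hh, one_mul]
    have h1 : h.smulRight w = generalizedDerivation A B V := by
      rw [← hv, hV, ← mul_apply_eq_comp, v.mul_inv, one_apply_eq_self]
    have h2 : (‖y‖ : ℂ) * f w = (f ∘L A) (V y) - f (V (B y)) := by
      have := congrArg f (DFunLike.congr_fun h1 y)
      simpa [generalizedDerivation_apply, hhy] using this
    have h3 : ‖y‖ * ‖f w‖ ≤ ‖f ∘L A‖ * (‖V‖ * ‖y‖) + ‖f‖ * (‖V‖ * ‖B y‖) := by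
      have : ‖y‖ * ‖f w‖ = ‖(‖y‖ : ℂ) * f w‖ := by simp
      rw [this, h2]
      refine (norm_sub_le _ _).trans (add_le_add ?_ ?_)
      · exact (le_opNorm _ _).trans (by gcongr; exact le_opNorm _ _)
      · exact (le_opNorm _ _).trans (by gcongr; exact le_opNorm _ _)
    have h4 : ‖y‖ * ‖f w‖ ≤ ‖y‖ * (2 * ε * K * ‖f‖ * ‖w‖) := by
      calc ‖y‖ * ‖f w‖ ≤ ‖f ∘L A‖ * (‖V‖ * ‖y‖) + ‖f‖ * (‖V‖ * ‖B y‖) := h3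
        _ ≤ (ε * ‖f‖) * ((K * ‖w‖) * ‖y‖) + ‖f‖ * ((K * ‖w‖) * (ε * ‖y‖)) := by gcongr
        _ = ‖y‖ * (2 * ε * K * ‖f‖ * ‖w‖) := by ring
    exact le_of_mul_le_mul_left h4 hy0
  have h1 : ‖f‖ ≤ 2 * ε * K * ‖f‖ := opNorm_le_bound _ (by positivity) hbound
  have h4 : ε * (2 * (K + 1)) = 1 := inv_mul_cancel₀ (by positivity)
  nlinarith

end Approximate

/-! ### Spectral inclusion for the generalized derivation. -/

section Spectrum

variable {E : Type*} [NormedAddCommGroup E] [NormedSpace ℂ E]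
variable {X : Type*} [NormedAddCommGroup X] [NormedSpace ℂ X]
variable {Y : Type*} [NormedAddCommGroup Y] [NormedSpace ℂ Y]

theorem mem_spectrum_iff_not_isUnit_sub {R : Type*} [Ring R] [Algebra ℂ R] {t : R} {z : ℂ} :
    z ∈ spectrum ℂ t ↔ ¬ IsUnit (t - algebraMap ℂ R z) := by
  rw [spectrum.mem_iff, ← IsUnit.neg_iff, neg_sub]

theorem generalizedDerivation_sub_algebraMap (A : X →L[ℂ] X) (B : Y →L[ℂ] Y) (a b : ℂ) :
    generalizedDerivation (A - algebraMap ℂ _ a) (B - algebraMap ℂ _ b) =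
      generalizedDerivation A B - algebraMap ℂ _ (a - b) := by
  ext U y
  simp [generalizedDerivation_apply, Algebra.algebraMap_eq_smul_one, sub_smul]
  abel

theorem sub_algebraMap_mem_closure_isUnit {R : Type*} [NormedRing R] [NormedAlgebra ℂ R] {t : R}
    {z : ℂ} (hz : z ∈ closure (spectrum ℂ t)ᶜ) :
    t - algebraMap ℂ R z ∈ closure {v : R | IsUnit v} := by
  have hcont : Continuous fun w : ℂ => t - algebraMap ℂ R w := by fun_prop
  refine map_mem_closure (f := fun w : ℂ => t - algebraMap ℂ R w) hcont hz fun w hw => ?_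
  rwa [Set.mem_compl_iff, mem_spectrum_iff_not_isUnit_sub, not_not] at hw

/-- The Lumer–Rosenblum inclusion: differences of spectral points of `A` and `B` belong to the
spectrum of the generalized derivation. -/
theorem sub_mem_spectrum_generalizedDerivation [CompleteSpace X] [CompleteSpace Y]
    {A : X →L[ℂ] X} {B : Y →L[ℂ] Y} {a b : ℂ}
    (ha : a ∈ spectrum ℂ A) (hb : b ∈ spectrum ℂ B) :
    a - b ∈ spectrum ℂ (generalizedDerivation A B) := by
  -- Translating both points by the same real r keeps a - b fixed. At the largest r for which both
  -- stay in their spectra, one of them is a limit of resolvent points.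
  set K : Set ℝ := {r | a + r ∈ spectrum ℂ A ∧ b + r ∈ spectrum ℂ B} with hK
  have hclosed : IsClosed K :=
    ((spectrum.isClosed A).preimage (by fun_prop : Continuous fun r : ℝ => a + (r : ℂ))).inter
      ((spectrum.isClosed B).preimage (by fun_prop : Continuous fun r : ℝ => b + (r : ℂ)))
  have hne : K.Nonempty := ⟨0, by simpa using ha, by simpa using hb⟩
  have hbdd : BddAbove K := by
    refine ⟨‖A‖ * ‖(1 : X →L[ℂ] X)‖ + ‖a‖, fun r hr => ?_⟩
    have h1 := spectrum.norm_le_norm_mul_of_mem hr.1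
    have h2 := norm_sub_le (a + (r : ℂ)) a
    rw [add_sub_cancel_left, Complex.norm_real] at h2
    exact (le_abs_self r).trans (h2.trans (by gcongr))
  obtain ⟨hrA, hrB⟩ := hclosed.csSup_mem hne hbdd
  set r := sSup K
  have hcl : (r : ℝ) ∈ closure ({r : ℝ | a + r ∈ (spectrum ℂ A)ᶜ} ∪
      {r : ℝ | b + r ∈ (spectrum ℂ B)ᶜ}) := by
    have : r ∈ closure (Set.Ioi r) := by rw [closure_Ioi]; exact Set.self_mem_Ici
    refine closure_mono (fun r' hr' => ?_) this
    by_contra hcon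
    simp only [Set.mem_union, Set.mem_ofPred_eq, Set.mem_compl_iff, not_or, not_not] at hcon
    exact absurd (le_csSup hbdd hcon) (not_le.2 hr')
  have hsub : a - b = (a + r) - (b + r) := by ring
  rw [hsub, mem_spectrum_iff_not_isUnit_sub, ← generalizedDerivation_sub_algebraMap]
  have hA' := mem_spectrum_iff_not_isUnit_sub.1 hrA
  have hB' := mem_spectrum_iff_not_isUnit_sub.1 hrB
  rw [closure_union] at hcl
  -- The operator at that boundary point has both an approximate kernel and an approximate cokernel,
  -- so it pairs with whichever defect the other operator has.
  rcases hcl with h | h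
  · have hmem : a + (r : ℂ) ∈ closure (spectrum ℂ A)ᶜ :=
      map_mem_closure (f := fun r : ℝ => a + (r : ℂ)) (by fun_prop) h fun _ h => h
    have hcl' := sub_algebraMap_mem_closure_isUnit hmem
    rcases hasApproxKernel_or_hasApproxCokernel hB' with h' | h'
    · exact not_isUnit_generalizedDerivation_of_cokernel_kernel
        (hasApproxCokernel_of_mem_closure hA' hcl') h'
    · exact not_isUnit_generalizedDerivation_of_kernel_cokernel
        (hasApproxKernel_of_mem_closure hA' hcl') h'
  · have hmem : b + (r : ℂ) ∈ closure (spectrum ℂ B)ᶜ :=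
      map_mem_closure (f := fun r : ℝ => b + (r : ℂ)) (by fun_prop) h fun _ h => h
    have hcl' := sub_algebraMap_mem_closure_isUnit hmem
    rcases hasApproxKernel_or_hasApproxCokernel hA' with h' | h'
    · exact not_isUnit_generalizedDerivation_of_kernel_cokernel h'
        (hasApproxCokernel_of_mem_closure hB' hcl')
    · exact not_isUnit_generalizedDerivation_of_cokernel_kernel h'
        (hasApproxKernel_of_mem_closure hB' hcl')

end Spectrum

end BanachOp

/-! ### Poles as points with a spectral idempotent. -/

namespace BanachOp

open ContinuousLinearMap

variable {E : Type*} [NormedAddCommGroup E] [NormedSpace ℂ E]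

theorem ker_pow_eq_of_ker_pow_eq {T : E →L[ℂ] E} {k m : ℕ}
    (h : (T ^ k).ker = (T ^ (k + 1)).ker) (hm : k ≤ m) : (T ^ m).ker = (T ^ k).ker := by
  induction m, hm using Nat.le_induction with
  | base => rfl
  | succ m hm ih =>
    rw [← ih]
    ext x
    obtain ⟨j, rfl⟩ := Nat.exists_eq_add_of_le hm
    constructor
    · intro hx
      have h1 : (T ^ j) x ∈ (T ^ (k + 1)).ker := by
        rw [LinearMap.mem_ker, coe_coe, ← mul_apply_eq_comp, ← pow_add]
        rw [LinearMap.mem_ker, coe_coe] at hx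
        convert hx using 3
        ring
      rw [← h, LinearMap.mem_ker, coe_coe, ← mul_apply_eq_comp, ← pow_add] at h1
      exact h1
    · intro hx
      rw [LinearMap.mem_ker, coe_coe] at hx ⊢
      rw [pow_succ', mul_apply_eq_comp, hx, map_zero]

theorem range_pow_eq_of_range_pow_eq {T : E →L[ℂ] E} {k m : ℕ}
    (h : (T ^ k).range = (T ^ (k + 1)).range) (hm : k ≤ m) : (T ^ m).range = (T ^ k).range := by
  induction m, hm using Nat.le_induction with
  | base => rfl
  | succ m hm ih =>
    rw [← ih]
    obtain ⟨j, rfl⟩ := Nat.exists_eq_add_of_le' hm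
    ext x
    constructor
    · rintro ⟨y, rfl⟩
      exact ⟨T y, by change (T ^ (j + k)) (T y) = (T ^ (j + k + 1)) y; rw [pow_succ, mul_apply_eq_comp]⟩
    · rintro ⟨y, rfl⟩
      obtain ⟨w, hw⟩ : (T ^ k) y ∈ (T ^ (k + 1)).range := h ▸ ⟨y, rfl⟩
      refine ⟨w, ?_⟩
      change (T ^ (j + k + 1)) w = (T ^ (j + k)) y
      change (T ^ (k + 1)) w = (T ^ k) y at hw
      rw [add_assoc, pow_add, mul_apply_eq_comp, hw, ← mul_apply_eq_comp, ← pow_add]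

theorem exists_ker_pow_eq_of_ascent_lt_top {T : E →L[ℂ] E} (h : ascent T < ⊤) :
    ∃ k : ℕ, (T ^ k).ker = (T ^ (k + 1)).ker := by
  simpa [ascent, iInf_lt_iff] using h

theorem exists_range_pow_eq_of_descent_lt_top {T : E →L[ℂ] E} (h : descent T < ⊤) :
    ∃ k : ℕ, (T ^ k).range = (T ^ (k + 1)).range := by
  simpa [descent, iInf_lt_iff] using h

/-- Off P, T ^ m coincides with the unit (T + P) ^ m, so only the range of P can be killed. -/
theorem ker_pow_eq_range_idempotent {T P : E →L[ℂ] E} (hP : IsIdempotentElem P)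
    (hc : Commute T P) (hu : IsUnit (T + P)) {m : ℕ} (hm : T ^ m * P = 0) :
    (T ^ m).ker = P.range := by
  obtain ⟨v, hv⟩ := hu.pow m
  ext x
  constructor
  · intro hx
    have h1 : (v : E →L[ℂ] E) ((1 - P) x) = 0 := by
      rw [← mul_apply_eq_comp, hv, add_pow_mul_one_sub hP hc, mul_sub, mul_one, hm, sub_zero]
      exact hx
    have h2 : (1 - P) x = 0 := by
      have h := congrArg (↑v⁻¹ : E →L[ℂ] E) h1
      rwa [← mul_apply_eq_comp, v.inv_mul, one_apply_eq_self, map_zero] at h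
    rw [sub_apply, one_apply_eq_self, sub_eq_zero] at h2
    exact ⟨x, h2.symm⟩
  · rintro ⟨y, rfl⟩
    exact DFunLike.congr_fun hm y

theorem range_pow_eq_ker_idempotent {T P : E →L[ℂ] E} (hP : IsIdempotentElem P)
    (hc : Commute T P) (hu : IsUnit (T + P)) {m : ℕ} (hm : T ^ m * P = 0) :
    (T ^ m).range = P.ker := by
  have hcomm : Commute ((T + P) ^ m) P := (hc.add_left (Commute.refl P)).pow_left m
  obtain ⟨v, hv⟩ := hu.pow m
  rw [← hv] at hcomm
  have hcinv : P * ↑v⁻¹ = ↑v⁻¹ * P := hcomm.symm.units_inv_right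
  ext x
  constructor
  · rintro ⟨y, rfl⟩
    have : P * T ^ m = 0 := by rw [← (hc.pow_left m).eq, hm]
    exact DFunLike.congr_fun this y
  · intro hx
    refine ⟨(↑v⁻¹ : E →L[ℂ] E) x, ?_⟩
    have h1 : P ((↑v⁻¹ : E →L[ℂ] E) x) = 0 := by
      rw [← mul_apply_eq_comp, hcinv, mul_apply_eq_comp]
      exact (congrArg _ hx).trans (map_zero _)
    have h2 := DFunLike.congr_fun (add_pow_mul_one_sub hP hc m) ((↑v⁻¹ : E →L[ℂ] E) x)
    rw [mul_apply_eq_comp, mul_apply_eq_comp, sub_apply, h1, one_apply_eq_self, sub_zero,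
      ← hv, ← mul_apply_eq_comp, v.mul_inv, one_apply_eq_self] at h2
    exact h2.symm

/-- Kernels and ranges both stabilise at k exactly when T ^ k * P = 0, so the two infima are over
the same set. -/
theorem HasSpectralIdempotent.ascent_eq_descent {T : E →L[ℂ] E} (hT : HasSpectralIdempotent T) :
    ascent T = descent T ∧ ascent T < ⊤ := by
  obtain ⟨P, hP, hc, ⟨n, hn⟩, hu⟩ := hT
  have hn' : T ^ (n + 1) * P = 0 := by
    rw [← pow_mul_idempotent hP hc n.succ_ne_zero, pow_succ, hn, zero_mul]
  have hup {m k : ℕ} (hmk : m ≤ k) (hm : T ^ m * P = 0) : T ^ k * P = 0 := by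
    rw [← Nat.sub_add_cancel hmk, pow_add, mul_assoc, hm, mul_zero]
  have hker (k : ℕ) : (T ^ k).ker = (T ^ (k + 1)).ker ↔ T ^ k * P = 0 := by
    refine ⟨fun h => ?_, fun h => ?_⟩
    · have h1 := ker_pow_eq_of_ker_pow_eq h (le_max_left k (n + 1))
      rw [ker_pow_eq_range_idempotent hP hc hu (hup (le_max_right k (n + 1)) hn')] at h1
      ext x
      exact h1.le ⟨x, rfl⟩
    · rw [ker_pow_eq_range_idempotent hP hc hu h,
        ker_pow_eq_range_idempotent hP hc hu (hup k.le_succ h)]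
  have hrange (k : ℕ) : (T ^ k).range = (T ^ (k + 1)).range ↔ T ^ k * P = 0 := by
    refine ⟨fun h => ?_, fun h => ?_⟩
    · have h1 := range_pow_eq_of_range_pow_eq h (le_max_left k (n + 1))
      rw [range_pow_eq_ker_idempotent hP hc hu (hup (le_max_right k (n + 1)) hn')] at h1
      rw [(hc.pow_left k).eq]
      ext x
      exact h1.ge ⟨x, rfl⟩
    · rw [range_pow_eq_ker_idempotent hP hc hu h,
        range_pow_eq_ker_idempotent hP hc hu (hup k.le_succ h)]
  refine ⟨by simp only [ascent, descent, hker, hrange], ?_⟩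
  simp only [ascent, hker]
  exact (iInf₂_le (n + 1) hn').trans_lt (ENat.natCast_lt_top _)

/-- An operator with `N(S) = N(S ^ 2)` and `R(S) = R(S ^ 2)` admits a bounded projection onto its
kernel along its range. -/
theorem exists_projection_ker_along_range [CompleteSpace E] {S : E →L[ℂ] E}
    (hker : ∀ x, S (S x) = 0 → S x = 0) (hrange : ∀ x, ∃ y, S (S y) = S x) :
    ∃ P : E →L[ℂ] E, ∀ x y, S x = 0 → P (x + S y) = x := by
  have hdecomp (x : E) : ∃ k y, S k = 0 ∧ x = k + S y := by
    obtain ⟨y, hy⟩ := hrange x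
    exact ⟨x - S y, y, by rw [map_sub, hy, sub_self], by abel⟩
  have hcompl : IsCompl S.ker S.range := by
    refine ⟨?_, ?_⟩
    · rw [Submodule.disjoint_def]
      rintro _ hx ⟨y, rfl⟩
      exact hker y hx
    · rw [codisjoint_iff, eq_top_iff]
      intro x _
      obtain ⟨k, y, hk, rfl⟩ := hdecomp x
      exact Submodule.add_mem_sup hk ⟨y, rfl⟩
  have hval (k y : E) (hk : S k = 0) :
      Submodule.projection S.ker S.range hcompl (k + S y) = k := by
    rw [map_add, Submodule.projection_apply_left hcompl ⟨k, hk⟩,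
      Submodule.projection_apply_right hcompl ⟨S y, ⟨y, rfl⟩⟩, add_zero]
  have hclosed : IsClosed (S.ker : Set E) := S.isClosed_ker
  have : CompleteSpace S.ker := hclosed.completeSpace_coe
  -- The open mapping theorem for ker S × E → E, (k, y) ↦ k + S y, bounds the kernel component
  -- without first knowing that the range is closed.
  obtain ⟨C, -, hC⟩ := exists_preimage_norm_le (S.ker.subtypeL.coprod S) fun x => by
    obtain ⟨k, y, hk, rfl⟩ := hdecomp x
    exact ⟨(⟨k, hk⟩, y), rfl⟩
  refine ⟨(Submodule.projection S.ker S.range hcompl).mkContinuous C fun x => ?_, hval⟩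
  obtain ⟨⟨k, y⟩, rfl, hky⟩ := hC x
  refine le_trans ?_ hky
  have : Submodule.projection S.ker S.range hcompl ((S.ker.subtypeL.coprod S) (k, y)) = k :=
    hval k y k.2
  rw [this]
  exact norm_fst_le (k, y)

theorem hasSpectralIdempotent_of_ascent_descent [CompleteSpace E] {T : E →L[ℂ] E}
    (ha : ascent T < ⊤) (hd : descent T < ⊤) : HasSpectralIdempotent T := by
  obtain ⟨k, hk⟩ := exists_ker_pow_eq_of_ascent_lt_top ha
  obtain ⟨l, hl⟩ := exists_range_pow_eq_of_descent_lt_top hd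
  -- Kernels and ranges are stable from n on; the exponent n + 1 is used because it is positive.
  set n := max k l
  have hSS : T ^ (n + 1) * T ^ (n + 1) = T ^ (n + 1 + (n + 1)) := (pow_add _ _ _).symm
  have hker (x : E) (hx : (T ^ (n + 1)) ((T ^ (n + 1)) x) = 0) : (T ^ (n + 1)) x = 0 := by
    rw [← mul_apply_eq_comp, hSS] at hx
    have h := (ker_pow_eq_of_ker_pow_eq hk (by omega : k ≤ n + 1 + (n + 1))).trans
      (ker_pow_eq_of_ker_pow_eq hk (by omega : k ≤ n + 1)).symm
    exact h.le hx
  have hrange (x : E) : ∃ y, (T ^ (n + 1)) ((T ^ (n + 1)) y) = (T ^ (n + 1)) x := by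
    have h := (range_pow_eq_of_range_pow_eq hl (by omega : l ≤ n + 1 + (n + 1))).trans
      (range_pow_eq_of_range_pow_eq hl (by omega : l ≤ n + 1)).symm
    obtain ⟨y, hy⟩ := h.ge ⟨x, rfl⟩
    exact ⟨y, by rw [← mul_apply_eq_comp, hSS]; exact hy⟩
  have hcomm (x : E) : (T ^ (n + 1)) (T x) = T ((T ^ (n + 1)) x) := by
    rw [← mul_apply_eq_comp, ← mul_apply_eq_comp, ← pow_succ, ← pow_succ']
  obtain ⟨P, hP⟩ := exists_projection_ker_along_range hker hrange
  set S := T ^ (n + 1) with hS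
  have hdecomp (x : E) : ∃ u y, S u = 0 ∧ x = u + S y := by
    obtain ⟨y, hy⟩ := hrange x
    exact ⟨x - S y, y, by rw [map_sub, hy, sub_self], by abel⟩
  have hPker (u : E) (hu : S u = 0) : P u = u := by simpa using hP u 0 hu
  refine hasSpectralIdempotent_of_pow (p := P) (n := n) ?_ ?_ ?_ ?_
  · ext x
    obtain ⟨u, y, hu, rfl⟩ := hdecomp x
    rw [mul_apply_eq_comp, hP u y hu, hPker u hu]
  · ext x
    obtain ⟨u, y, hu, rfl⟩ := hdecomp x
    rw [mul_apply_eq_comp, mul_apply_eq_comp, hP u y hu, map_add, ← hcomm,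
      hP (T u) (T y) (by rw [hcomm, hu, map_zero])]
  · ext x
    obtain ⟨u, y, hu, rfl⟩ := hdecomp x
    rw [← hS, mul_apply_eq_comp, hP u y hu, hu, zero_apply]
  · rw [← hS, isUnit_iff_bijective]
    have hval (u y : E) (hu : S u = 0) : (S + P) (u + S y) = u + S (S y) := by
      rw [add_apply, hP u y hu, map_add, hu, zero_add, add_comm]
    refine ⟨(injective_iff_map_eq_zero _).2 fun x hx => ?_, fun x => ?_⟩
    · obtain ⟨u, y, hu, rfl⟩ := hdecomp x
      rw [hval u y hu] at hx
      have hu0 : u = 0 := by rw [← hP u (S y) hu, hx, map_zero]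
      rw [hu0, zero_add] at hx ⊢
      exact hker y hx
    · obtain ⟨u, y, hu, rfl⟩ := hdecomp x
      obtain ⟨w, hw⟩ := hrange y
      exact ⟨u + S w, by rw [hval u w hu, hw]⟩

theorem mem_poles_iff [CompleteSpace E] {T : E →L[ℂ] E} {z : ℂ} :
    z ∈ poles T ↔ z ∈ spectrum ℂ T ∧ HasSpectralIdempotent (T - algebraMap ℂ _ z) := by
  have hid : algebraMap ℂ (E →L[ℂ] E) z = z • ContinuousLinearMap.id ℂ E :=
    Algebra.algebraMap_eq_smul_one z
  rw [hid]
  refine and_congr_right fun _ => ⟨fun h => ?_, fun h => h.ascent_eq_descent⟩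
  exact hasSpectralIdempotent_of_ascent_descent h.2 (h.1 ▸ h.2)

theorem mem_iso_iff {K : Set ℂ} {z : ℂ} :
    z ∈ iso K ↔ z ∈ K ∧ ∀ᶠ w in nhdsWithin z {z}ᶜ, w ∉ K := by
  rw [iso, Set.mem_sdiff, mem_derivedSet, accPt_iff_frequently_nhdsNE, Filter.not_frequently]

end BanachOp

namespace BanachOp

/-! ### Isolated spectral points and polaroid operators. -/

section Isolated

variable {E : Type*} [NormedAddCommGroup E] [NormedSpace ℂ E] [CompleteSpace E]

theorem poles_subset_iso (T : E →L[ℂ] E) : poles T ⊆ iso (spectrum ℂ T) := by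
  intro z hz
  obtain ⟨hz, hs⟩ := mem_poles_iff.1 hz
  refine mem_iso_iff.2 ⟨hz, ?_⟩
  have htend : Filter.Tendsto (fun w : ℂ => w - z) (nhdsWithin z {z}ᶜ) (nhdsWithin 0 {0}ᶜ) := by
    refine tendsto_nhdsWithin_iff.2 ⟨tendsto_nhdsWithin_of_tendsto_nhds ?_, ?_⟩
    · have : Continuous fun w : ℂ => w - z := by fun_prop
      simpa using this.tendsto z
    · filter_upwards [self_mem_nhdsWithin] with w hw
      exact sub_ne_zero.2 hw
  filter_upwards [htend.eventually hs.eventually_isUnit] with w hw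
  rw [mem_spectrum_iff_not_isUnit_sub, not_not]
  convert hw using 1
  rw [map_sub]
  abel

theorem IsPolaroid.hasSpectralIdempotent {T : E →L[ℂ] E} (hT : IsPolaroid T) {z : ℂ}
    (hz : z ∈ iso (spectrum ℂ T)) : HasSpectralIdempotent (T - algebraMap ℂ _ z) := by
  rw [hT] at hz
  exact (mem_poles_iff.1 hz).2

theorem isPolaroid_of_hasSpectralIdempotent {T : E →L[ℂ] E}
    (h : ∀ z ∈ iso (spectrum ℂ T), HasSpectralIdempotent (T - algebraMap ℂ _ z)) : IsPolaroid T :=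
  Set.Subset.antisymm (fun z hz => mem_poles_iff.2 ⟨hz.1, h z hz⟩) (poles_subset_iso T)

/-- A point of `K` that an injective continuous map carrying `K` into `L` sends to an isolated point
of `L` is isolated in `K`. -/
theorem mem_iso_of_map_mem_iso {K L : Set ℂ} {f : ℂ → ℂ} (hf : Continuous f)
    (hinj : Function.Injective f) (hKL : Set.MapsTo f K L) {z : ℂ} (hz : z ∈ K)
    (hfz : f z ∈ iso L) : z ∈ iso K := by
  refine mem_iso_iff.2 ⟨hz, ?_⟩
  have htend : Filter.Tendsto f (nhdsWithin z {z}ᶜ) (nhdsWithin (f z) {f z}ᶜ) := by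
    refine tendsto_nhdsWithin_iff.2 ⟨tendsto_nhdsWithin_of_tendsto_nhds (hf.tendsto z), ?_⟩
    filter_upwards [self_mem_nhdsWithin] with w hw
    exact hinj.ne hw
  filter_upwards [htend.eventually (mem_iso_iff.1 hfz).2] with w hw hwK
  exact hw (hKL hwK)

/-- An infinite F would accumulate at a point of K; closedness puts that point in F, where points
are isolated. -/
theorem finite_of_subset_iso {K F : Set ℂ} (hK : IsCompact K) (hF : F ⊆ iso K) (hcl : IsClosed F) :
    F.Finite := by
  by_contra hinf
  obtain ⟨x, -, hx⟩ := Set.Infinite.exists_accPt_of_subset_isCompact hinf hK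
    (hF.trans Set.sdiff_subset)
  have hxF : x ∈ F := by
    have := hx.clusterPt
    rwa [← mem_closure_iff_clusterPt, hcl.closure_eq] at this
  exact (hF hxF).2 (hx.mono (Filter.principal_mono.2 (hF.trans Set.sdiff_subset)))

end Isolated

/-! ### Left and right multiplications as algebra homomorphisms. -/

section Multiplications

variable (X Y : Type*) [NormedAddCommGroup X] [NormedSpace ℂ X]
variable [NormedAddCommGroup Y] [NormedSpace ℂ Y]

/-- Left multiplications, as an algebra homomorphism. -/
noncomputable def leftMulHom : (X →L[ℂ] X) →ₐ[ℂ] ((Y →L[ℂ] X) →L[ℂ] (Y →L[ℂ] X)) :=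
  AlgHom.ofLinearMap (ContinuousLinearMap.compL ℂ Y X X).toLinearMap rfl fun _ _ => rfl

/-- Right multiplications, as an algebra homomorphism on the opposite algebra. -/
noncomputable def rightMulHom : (Y →L[ℂ] Y)ᵐᵒᵖ →ₐ[ℂ] ((Y →L[ℂ] X) →L[ℂ] (Y →L[ℂ] X)) :=
  AlgHom.ofLinearMap ((ContinuousLinearMap.compL ℂ Y Y X).flip.toLinearMap.comp
    (MulOpposite.opLinearEquiv ℂ).symm.toLinearMap) rfl fun _ _ => rfl

variable {X Y}

theorem generalizedDerivation_eq_sub (A : X →L[ℂ] X) (B : Y →L[ℂ] Y) :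
    generalizedDerivation A B = leftMulHom X Y A - rightMulHom X Y (MulOpposite.op B) := rfl

theorem commute_leftMulHom_rightMulHom (A : X →L[ℂ] X) (B : Y →L[ℂ] Y) :
    Commute (leftMulHom X Y A) (rightMulHom X Y (MulOpposite.op B)) := rfl

theorem spectrum_leftMulHom_subset (A : X →L[ℂ] X) :
    spectrum ℂ (leftMulHom X Y A) ⊆ spectrum ℂ A :=
  AlgHom.spectrum_apply_subset _ A

theorem spectrum_rightMulHom_subset (B : Y →L[ℂ] Y) :
    spectrum ℂ (rightMulHom X Y (MulOpposite.op B)) ⊆ spectrum ℂ B := by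
  refine (AlgHom.spectrum_apply_subset (rightMulHom X Y) (MulOpposite.op B)).trans fun z hz h => ?_
  exact hz (IsUnit.op h)

end Multiplications

/-! ### The polaroid property of the generalized derivation. -/

section Main

variable {X Y : Type*} [NormedAddCommGroup X] [NormedSpace ℂ X] [CompleteSpace X]
variable [NormedAddCommGroup Y] [NormedSpace ℂ Y] [CompleteSpace Y]

theorem IsPolaroid.generalizedDerivation {A : X →L[ℂ] X} {B : Y →L[ℂ] Y} (hA : IsPolaroid A)
    (hB : IsPolaroid B) : IsPolaroid (generalizedDerivation A B) := by
  refine isPolaroid_of_hasSpectralIdempotent fun z hz => ?_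
  set F : Set ℂ := {α | α ∈ spectrum ℂ A ∧ α - z ∈ spectrum ℂ B}
  -- The translate of σ(A) by -(α - z) lies in σ(ρ) and carries α to the isolated point z; `hFB`
  -- uses the reflection w ↦ α - w of σ(B).
  have hFA : F ⊆ iso (spectrum ℂ A) := fun α hα =>
    mem_iso_of_map_mem_iso (f := fun w => w - (α - z)) (by fun_prop) (sub_left_injective)
      (fun w hw => sub_mem_spectrum_generalizedDerivation hw hα.2) hα.1 (by simpa using hz)
  have hFB (α : ℂ) (hα : α ∈ F) : α - z ∈ iso (spectrum ℂ B) :=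
    mem_iso_of_map_mem_iso (f := fun w => α - w) (by fun_prop) (sub_right_injective)
      (fun w hw => sub_mem_spectrum_generalizedDerivation hα.1 hw) hα.2 (by simpa using hz)
  have hFcl : IsClosed F := (spectrum.isClosed A).inter
    ((spectrum.isClosed B).preimage (by fun_prop : Continuous fun α : ℂ => α - z))
  have hfin : F.Finite := finite_of_subset_iso (spectrum.isCompact A) hFA hFcl
  rw [generalizedDerivation_eq_sub]
  refine hasSpectralIdempotent_sub (commute_leftMulHom_rightMulHom A B) hfin.toFinset
    (fun α hα => ?_) (fun α hα => ?_) fun α h1 h2 => ?_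
  · rw [hfin.mem_toFinset] at hα
    have := (hA.hasSpectralIdempotent (hFA hα)).map (leftMulHom X Y)
    rwa [map_sub, AlgHom.commutes] at this
  · rw [hfin.mem_toFinset] at hα
    have := (hB.hasSpectralIdempotent (hFB α hα)).op.map (rightMulHom X Y)
    rwa [MulOpposite.op_sub, map_sub, ← MulOpposite.algebraMap_apply, AlgHom.commutes] at this
  · rw [hfin.mem_toFinset]
    exact ⟨spectrum_leftMulHom_subset A h1, spectrum_rightMulHom_subset B h2⟩

end Main

end BanachOp

theorem theorem3p6 {X Y : Type*}
    [NormedAddCommGroup X] [NormedSpace ℂ X] [CompleteSpace X]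
    [NormedAddCommGroup Y] [NormedSpace ℂ Y] [CompleteSpace Y]
    (A : X →L[ℂ] X) (B : Y →L[ℂ] Y)
    (hA : BanachOp.IsPolaroid A) (hB : BanachOp.IsPolaroid B) :
    BanachOp.IsPolaroid (BanachOp.generalizedDerivation A B) :=
  hA.generalizedDerivation hB
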